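/- Let $G=\mathrm{PSL}_2(\mathbb R)=\mathrm{SL}_2(\mathbb R)/\{\pm1\}$ and let $\Gamma\subset G$ be a torsion-free discrete subgroup of finite covolume. Let $n\ge 1$ be an even integer and let $V=\mathcal P_n(\mathbb R)$ be the real vector space of homogeneous polynomials $f(X,Y)$ of degree $n$ with real coefficients, on which $\mathrm{SL}_2(\mathbb R)$ acts by $(\gamma f)\binom XY=f\bigl(\gamma^{-1}\binom XY\bigr)$. As $n$ is even, $-1$ acts trivially, so $G$ acts on $V$ and $V$ is a module over the group ring $A=\mathbb R[\Gamma]$. Let $I\subset A$ be the augmentation ideal, i.e. the kernel of the map $\sum_\gamma a_\gamma\gamma\mapsto\sum_\gamma a_\gamma$, and for an ideal $J\subset A$ put $V^J=\{v\in V: Jv=0\}$. Then $$V^{I^q}=0\qquad\text{for every integer } q\ge 0 .$$ -/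

import Mathlib

open MeasureTheory

noncomputable section

namespace HigherOrder

section GroupRing

variable (R : Type*) [CommRing R]

/-- The augmentation map `R[Γ] → R`, `∑ a_γ γ ↦ ∑ a_γ`. -/
def augmentation (Γ : Type*) [Group Γ] : MonoidAlgebra R Γ →ₐ[R] R :=
  MonoidAlgebra.lift R R Γ (1 : Γ →* R)

theorem augmentation_apply (Γ : Type*) [Group Γ] (m : MonoidAlgebra R Γ) :
    augmentation R Γ m = m.coeff.sum fun _ a => a := by
  simp [augmentation, MonoidAlgebra.lift_apply]

/-- The augmentation ideal `I` of the group ring `R[Γ]`. -/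
def augmentationIdeal (Γ : Type*) [Group Γ] : Ideal (MonoidAlgebra R Γ) :=
  RingHom.ker (augmentation R Γ)

/-- For an ideal `J` of an `R`-algebra `A` and an `A`-module `V`,
the `R`-submodule `V^J` of all `v ∈ V` with `J v = 0`. -/
def annihilatedBy {A : Type*} [Ring A] [Algebra R A] (V : Type*) [AddCommGroup V]
    [Module R V] [Module A V] [IsScalarTower R A V] (J : Ideal A) : Submodule R V where
  carrier := {v | ∀ m ∈ J, m • v = 0}
  zero_mem' := fun m _ => smul_zero m
  add_mem' := fun {v w} hv hw m hm => by rw [smul_add, hv m hm, hw m hm, add_zero]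
  smul_mem' := fun c v hv m hm => by
    rw [← algebraMap_smul A c v, ← mul_smul, ← Algebra.commutes, mul_smul, hv m hm, smul_zero]

end GroupRing

section Polynomials

/-- `SL₂(ℝ)` -/
abbrev SL2R : Type := Matrix.SpecialLinearGroup (Fin 2) ℝ

/-- `PSL₂(ℝ)`, the quotient of `SL₂(ℝ)` by its centre `{±1}`, with the quotient topology. -/
abbrev PSL2R : Type := Matrix.ProjectiveSpecialLinearGroup (Fin 2) ℝ

/-- `𝒫ₙ(ℝ)`: homogeneous real polynomials of degree `n` in two variables
(`X` is the variable `0`, `Y` is the variable `1`). -/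
abbrev Pn (n : ℕ) : Type := MvPolynomial.homogeneousSubmodule (Fin 2) ℝ n

/-- The substitution `f(X, Y) ↦ f(M (X, Y)ᵗ)` on polynomials, for a `2 × 2` matrix `M`. -/
def linSubst (M : Matrix (Fin 2) (Fin 2) ℝ) :
    MvPolynomial (Fin 2) ℝ →ₐ[ℝ] MvPolynomial (Fin 2) ℝ :=
  MvPolynomial.aeval fun i => ∑ j, MvPolynomial.C (M i j) * MvPolynomial.X j

theorem eval_linSubst (M : Matrix (Fin 2) (Fin 2) ℝ) (f : MvPolynomial (Fin 2) ℝ)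
    (x : Fin 2 → ℝ) : MvPolynomial.eval x (linSubst M f) = MvPolynomial.eval (M.mulVec x) f := by
  induction f using MvPolynomial.induction_on with
  | C a => simp [linSubst]
  | add p q hp hq => simp [hp, hq]
  | mul_X p i hp =>
    rw [map_mul, map_mul, map_mul, hp, MvPolynomial.eval_X]
    simp only [linSubst, MvPolynomial.aeval_X, map_sum, map_mul, MvPolynomial.eval_C,
      MvPolynomial.eval_X]
    rfl

theorem linSubst_isHomogeneous (M : Matrix (Fin 2) (Fin 2) ℝ) {n : ℕ}
    {f : MvPolynomial (Fin 2) ℝ} (hf : f.IsHomogeneous n) : (linSubst M f).IsHomogeneous n := by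
  have h := hf.aeval (S := ℝ) (fun i => ∑ j, MvPolynomial.C (M i j) * MvPolynomial.X j) (n := 1)
    (fun i => MvPolynomial.IsHomogeneous.sum _ _ _ fun j _ =>
      by simpa using (MvPolynomial.isHomogeneous_C_mul_X (M i j) j))
  simpa [linSubst] using h

theorem linSubst_one (f : MvPolynomial (Fin 2) ℝ) : linSubst 1 f = f :=
  MvPolynomial.funext fun x => by rw [eval_linSubst, Matrix.one_mulVec]

theorem linSubst_mul (M N : Matrix (Fin 2) (Fin 2) ℝ) (f : MvPolynomial (Fin 2) ℝ) :
    linSubst (M * N) f = linSubst N (linSubst M f) :=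
  MvPolynomial.funext fun x => by
    rw [eval_linSubst, eval_linSubst, eval_linSubst, Matrix.mulVec_mulVec]

/-- The representation of `SL₂(ℝ)` on `𝒫ₙ(ℝ)` given by
`(γ f)(X, Y) = f(γ⁻¹ (X, Y)ᵗ)`. -/
def repSL (n : ℕ) : Representation ℝ SL2R (Pn n) where
  toFun γ := (linSubst (γ⁻¹ : SL2R).1).toLinearMap.restrict
    fun _ hf => linSubst_isHomogeneous _ hf
  map_one' := by
    ext1 f
    apply Subtype.ext
    simpa using linSubst_one f.1
  map_mul' γ δ := by
    ext1 f
    apply Subtype.ext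
    have := linSubst_mul (δ⁻¹ : SL2R).1 (γ⁻¹ : SL2R).1 f.1
    rw [← Matrix.SpecialLinearGroup.coe_mul, ← mul_inv_rev] at this
    exact this

/-- For even `n` the centre `{±1}` acts trivially on `𝒫ₙ(ℝ)`. -/
theorem center_le_ker_repSL {n : ℕ} (hn : Even n) :
    Subgroup.center SL2R ≤ (repSL n : SL2R →* (Pn n →ₗ[ℝ] Pn n)).ker := by
  intro γ hγ
  obtain ⟨r, hr, hM⟩ := Matrix.SpecialLinearGroup.mem_center_iff.mp (inv_mem hγ)
  rw [MonoidHom.mem_ker]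
  ext1 f
  apply Subtype.ext
  change linSubst (γ⁻¹ : SL2R).1 f.1 = f.1
  have hr2 : r ^ 2 = 1 := by simpa using hr
  refine MvPolynomial.funext fun x => ?_
  have hrn : r ^ n = 1 := by
    obtain ⟨k, rfl⟩ := hn
    rw [← two_mul, pow_mul, hr2, one_pow]
  have hx : (γ⁻¹ : SL2R).1.mulVec x = r • x := by
    rw [← hM, Matrix.scalar_apply]
    ext i
    simp [Matrix.mulVec_diagonal]
  have hf : f.1.IsHomogeneous n := f.2
  rw [eval_linSubst, hx]
  rw [MvPolynomial.eval_eq, MvPolynomial.eval_eq]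
  refine Finset.sum_congr rfl fun d hd => ?_
  have hdn : ∑ i ∈ d.support, d i = n := by
    simpa [Finsupp.weight_apply, Finsupp.sum] using hf (MvPolynomial.mem_support_iff.mp hd)
  simp only [Pi.smul_apply, smul_eq_mul, mul_pow, Finset.prod_mul_distrib]
  rw [Finset.prod_pow_eq_pow_sum, hdn, hrn, one_mul]

/-- For even `n`, the representation `pₙ` of `PSL₂(ℝ)` on `𝒫ₙ(ℝ)` induced by `repSL n`. -/
def repPSL (n : ℕ) (hn : Even n) : Representation ℝ PSL2R (Pn n) :=
  QuotientGroup.lift (Subgroup.center SL2R) (repSL n) (center_le_ker_repSL hn)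

/-- `𝒫ₙ(ℝ)` as a module over the group ring `ℝ[Γ]` of a subgroup `Γ` of `PSL₂(ℝ)`. -/
abbrev PnModule (n : ℕ) (hn : Even n) (Γ : Subgroup PSL2R) : Type :=
  Representation.asModule ((repPSL n hn).comp Γ.subtype : Representation ℝ Γ (Pn n))

end Polynomials

/-- `Γ` has finite covolume in `G = PSL₂(ℝ)`: the homogeneous space `G / Γ` carries a nonzero
finite Borel measure that is invariant under left translation by `G`. -/
def HasFiniteCovolume (Γ : Subgroup PSL2R) : Prop :=
  letI : MeasurableSpace (PSL2R ⧸ Γ) := borel (PSL2R ⧸ Γ)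
  ∃ μ : Measure (PSL2R ⧸ Γ),
    IsFiniteMeasure μ ∧ μ ≠ 0 ∧ SMulInvariantMeasure PSL2R (PSL2R ⧸ Γ) μ

end HigherOrder

end

namespace HigherOrder

section Annihilators

variable {R : Type*} [CommRing R] {A V : Type*} [Ring A] [Algebra R A] [AddCommGroup V]
  [Module R V] [Module A V] [IsScalarTower R A V]

/-! Since $I^{q+1}=I\cdot I^q$, induction on $q$ reduces the claim to $V^I=0$, that is, to the
absence of nonzero $\Gamma$-invariant polynomials. For invariant $f$ and a point $p$, the value
$(gf)(p)$ depends only on $g\Gamma$, giving a continuous function on $G/\Gamma$ (`orbitEval`). At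
$p=(1,0)$ a diagonal translation multiplies it by $2^n>1$, which a finite invariant measure allows
only if it vanishes a.e. (`ae_eq_zero_of_comp_eq_mul`). Translating carries this to every $p$ off
the second axis; countably many such $p$ determine a polynomial, so $gf=0$ for some $g$, whence
$f=0$. -/

/-- If only zero is killed by the ideal `J`, then only zero is killed by each power of `J`. -/
theorem annihilatedBy_pow_eq_bot {J : Ideal A} [J.IsTwoSided]
    (h : ∀ v : V, (∀ m ∈ J, m • v = 0) → v = 0)
    (q : ℕ) : annihilatedBy R V (J ^ q) = ⊥ := by
  rw [eq_bot_iff]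
  induction q with
  | zero =>
    intro v hv
    have hone : (1 : A) ∈ J ^ 0 := by
      rw [Submodule.pow_zero]
      exact Submodule.one_le.mp le_rfl
    simpa using hv 1 hone
  | succ q ih =>
    intro v hv
    refine ih fun m hm => h _ fun a ha => ?_
    rw [← mul_smul]
    refine hv _ ?_
    -- The new factor must split off on the left, because `a` acts after `m`.
    rw [Ideal.IsTwoSided.pow_succ]
    exact Ideal.mul_mem_mul ha hm

end Annihilators

instance (R Γ : Type*) [CommRing R] [Group Γ] : (augmentationIdeal R Γ).IsTwoSided :=
  inferInstanceAs (RingHom.ker (augmentation R Γ)).IsTwoSided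

/-- A vector killed by the augmentation ideal is invariant under the group. -/
theorem invariant_of_augmentationIdeal_smul_eq_zero {R Γ W : Type*} [CommRing R] [Group Γ]
    [AddCommGroup W] [Module R W] (ρ : Representation R Γ W) (v : ρ.asModule)
    (hv : ∀ m ∈ augmentationIdeal R Γ, m • v = 0) (γ : Γ) :
    ρ γ (ρ.asModuleEquiv v) = ρ.asModuleEquiv v := by
  have hm : MonoidAlgebra.of R Γ γ - 1 ∈ augmentationIdeal R Γ := by
    simp [augmentationIdeal, RingHom.mem_ker, augmentation]
  have := hv _ hm
  rw [sub_smul, one_smul, sub_eq_zero] at this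
  rw [← ρ.asAlgebraHom_of, ← ρ.asModuleEquiv_map_smul, this]

section Recurrence

variable {X : Type*} [MeasurableSpace X]

/-- A measurable function that is scaled by a factor `c > 1` under a transformation preserving a
finite measure vanishes almost everywhere. -/
theorem ae_eq_zero_of_comp_eq_mul {μ : Measure X} [IsFiniteMeasure μ] {T : X → X}
    (hT : ∀ s, MeasurableSet s → μ (T ⁻¹' s) = μ s) {φ : X → ℝ} (hφ : Measurable φ)
    {c : ℝ} (hc : 1 < c) (hφT : ∀ x, φ (T x) = c * φ x) : ∀ᵐ x ∂μ, φ x = 0 := by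
  have hmeas : ∀ s : ℝ, MeasurableSet {x | s < |φ x|} := fun s =>
    measurableSet_lt measurable_const (by fun_prop)
  have hc0 : 0 < c := zero_lt_one.trans hc
  -- `T` pulls the superlevel set at `c ^ (k + 1) * s` back to the one at `c ^ k * s`.
  have hscale : ∀ (k : ℕ) (s : ℝ), μ {x | c ^ k * s < |φ x|} = μ {x | s < |φ x|} := by
    intro k
    induction k with
    | zero => simp
    | succ k ih =>
      intro s
      rw [← ih s, ← hT _ (hmeas (c ^ (k + 1) * s))]
      congr 1
      ext x
      simp only [Set.mem_preimage, Set.mem_ofPred_eq, hφT, abs_mul, abs_of_pos hc0]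
      rw [pow_succ', mul_assoc, mul_lt_mul_iff_right₀ hc0]
  have hzero : ∀ s : ℝ, 0 < s → μ {x | s < |φ x|} = 0 := by
    intro s hs
    -- These sets of equal measure decrease to `∅`; finiteness of `μ` gives continuity from above.
    have hlim := tendsto_measure_iInter_atTop (μ := μ) (s := fun k : ℕ => {x | c ^ k * s < |φ x|})
      (fun k => (hmeas _).nullMeasurableSet)
      (fun i j hij x hx => lt_of_le_of_lt
        (mul_le_mul_of_nonneg_right (pow_le_pow_right₀ hc.le hij) hs.le) hx)
      ⟨0, measure_ne_top _ _⟩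
    have hempty : ⋂ k : ℕ, {x | c ^ k * s < |φ x|} = ∅ := by
      refine Set.eq_empty_of_forall_notMem fun x hx => ?_
      obtain ⟨k, hk⟩ := pow_unbounded_of_one_lt (|φ x| / s) hc
      rw [div_lt_iff₀ hs] at hk
      exact lt_asymm hk (Set.mem_iInter.mp hx k)
    rw [hempty, measure_empty] at hlim
    refine tendsto_nhds_unique tendsto_const_nhds (hlim.congr fun k => hscale k s)
  have hall : ∀ᵐ x ∂μ, ∀ k : ℕ, ¬ (1 / ((k : ℝ) + 1) < |φ x|) := by
    rw [ae_all_iff]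
    intro k
    rw [ae_iff]
    simpa using hzero (1 / ((k : ℝ) + 1)) (by positivity)
  filter_upwards [hall] with x hx
  by_contra hne
  obtain ⟨k, hk⟩ := exists_nat_one_div_lt (abs_pos.mpr hne)
  exact hx k hk

end Recurrence

section Orbits

variable {n : ℕ} {hn : Even n} {Γ : Subgroup PSL2R} {f : Pn n}

/-- The value at `p` of the translate `g f` of a `Γ`-invariant polynomial `f`,
as a function of the coset `g Γ`. -/
noncomputable def orbitEval (hf : ∀ γ ∈ Γ, repPSL n hn γ f = f) (p : Fin 2 → ℝ) : PSL2R ⧸ Γ → ℝ :=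
  Quotient.lift (fun g : PSL2R => MvPolynomial.eval p (repPSL n hn g f).1) fun g h hgh => by
    have hγ := hf _ (QuotientGroup.leftRel_apply.mp hgh)
    have : repPSL n hn h f = repPSL n hn g f := by
      conv_rhs => rw [← hγ]
      rw [← Module.End.mul_apply, ← map_mul, mul_inv_cancel_left]
    simp only [this]

theorem orbitEval_mk (hf : ∀ γ ∈ Γ, repPSL n hn γ f = f) (p : Fin 2 → ℝ) (g : PSL2R) :
    orbitEval hf p (g : PSL2R ⧸ Γ) = MvPolynomial.eval p (repPSL n hn g f).1 := rfl

theorem eval_repPSL_mk (g : SL2R) (f : Pn n) (p : Fin 2 → ℝ) :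
    MvPolynomial.eval p (repPSL n hn (QuotientGroup.mk g) f).1 =
      MvPolynomial.eval ((g⁻¹).1.mulVec p) f.1 :=
  eval_linSubst _ _ _

theorem continuous_orbitEval (hf : ∀ γ ∈ Γ, repPSL n hn γ f = f) (p : Fin 2 → ℝ) :
    Continuous (orbitEval hf p) := by
  refine Continuous.quotient_lift ?_ _
  refine (QuotientGroup.isQuotientMap_mk _).continuous_iff.mpr ?_
  have hcomp : (fun g : PSL2R => MvPolynomial.eval p (repPSL n hn g f).1) ∘ QuotientGroup.mk =
      fun g : SL2R => MvPolynomial.eval ((g⁻¹).1.mulVec p) f.1 :=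
    funext fun g => eval_repPSL_mk g f p
  rw [hcomp]
  refine (MvPolynomial.continuous_eval f.1).comp ?_
  have hinv : Continuous fun g : SL2R => (g⁻¹).1 :=
    continuous_subtype_val.comp (continuous_inv (G := SL2R))
  exact hinv.matrix_mulVec continuous_const

/-- Trades a translation of $G/\Gamma$ for a motion of the evaluation point. -/
theorem orbitEval_smul (hf : ∀ γ ∈ Γ, repPSL n hn γ f = f) (p : Fin 2 → ℝ) (h : SL2R)
    (x : PSL2R ⧸ Γ) :
    orbitEval hf p ((QuotientGroup.mk h : PSL2R) • x) =
      orbitEval hf ((h⁻¹).1.mulVec p) x := by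
  induction x using QuotientGroup.induction_on with
  | H g =>
    change MvPolynomial.eval p (repPSL n hn ((QuotientGroup.mk h : PSL2R) * g) f).1 = _
    rw [map_mul, Module.End.mul_apply, eval_repPSL_mk, orbitEval_mk]

theorem orbitEval_smul_point (hf : ∀ γ ∈ Γ, repPSL n hn γ f = f) (c : ℝ) (p : Fin 2 → ℝ)
    (x : PSL2R ⧸ Γ) : orbitEval hf (c • p) x = c ^ n * orbitEval hf p x := by
  induction x using QuotientGroup.induction_on with
  | H g =>
    rw [orbitEval_mk, orbitEval_mk]
    have hg : (repPSL n hn g f).1.IsHomogeneous n := (repPSL n hn g f).2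
    rw [MvPolynomial.eval_eq, MvPolynomial.eval_eq, Finset.mul_sum]
    refine Finset.sum_congr rfl fun d hd => ?_
    have hdn : ∑ i ∈ d.support, d i = n := by
      simpa [Finsupp.weight_apply, Finsupp.sum] using hg (MvPolynomial.mem_support_iff.mp hd)
    simp only [Pi.smul_apply, smul_eq_mul, mul_pow, Finset.prod_mul_distrib]
    rw [Finset.prod_pow_eq_pow_sum, hdn]
    ring

/-- The matrix with first column `(a, b)` and second column `(0, 1 / a)`. -/
noncomputable def lowerTriangular (a b : ℝ) (ha : a ≠ 0) : SL2R :=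
  ⟨!![a, 0; b, a⁻¹], by simp [Matrix.det_fin_two, ha]⟩

theorem lowerTriangular_mulVec (a b : ℝ) (ha : a ≠ 0) :
    (lowerTriangular a b ha).1.mulVec ![1, 0] = ![a, b] := by
  ext i
  fin_cases i <;> simp [lowerTriangular, Matrix.mulVec, dotProduct]

/-- Over a quotient of finite covolume, the translates of an invariant polynomial of positive
degree vanish almost everywhere at a given point off the second axis. -/
theorem ae_orbitEval_eq_zero (hn1 : 1 ≤ n) (hf : ∀ γ ∈ Γ, repPSL n hn γ f = f)
    [MeasurableSpace (PSL2R ⧸ Γ)] [BorelSpace (PSL2R ⧸ Γ)]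
    (μ : Measure (PSL2R ⧸ Γ)) [IsFiniteMeasure μ] [SMulInvariantMeasure PSL2R (PSL2R ⧸ Γ) μ]
    (a b : ℝ) (ha : a ≠ 0) : ∀ᵐ x ∂μ, orbitEval hf ![a, b] x = 0 := by
  have hmeas := (continuous_orbitEval hf ![1, 0]).measurable
  have hinv : ∀ (g : PSL2R) (s : Set (PSL2R ⧸ Γ)), MeasurableSet s →
      μ ((fun x => g • x) ⁻¹' s) = μ s :=
    fun g s hs => SMulInvariantMeasure.measure_preimage_smul g hs
  have hbase : ∀ᵐ x ∂μ, orbitEval hf ![1, 0] x = 0 := by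
    -- The inverse of $\mathrm{diag}(2,1/2)$ replaces $(1,0)$ by $2\cdot(1,0)$, hence the factor `2
    -- ^ n`.
    refine ae_eq_zero_of_comp_eq_mul
      (hinv (QuotientGroup.mk (lowerTriangular 2 0 two_ne_zero)⁻¹ : PSL2R)) hmeas
      (one_lt_pow₀ (one_lt_two : (1 : ℝ) < 2) (by omega : n ≠ 0)) fun x => ?_
    rw [orbitEval_smul, inv_inv, lowerTriangular_mulVec, ← orbitEval_smul_point]
    congr 1
    simp
  rw [ae_iff] at hbase ⊢
  have hset : MeasurableSet {x | ¬orbitEval hf ![1, 0] x = 0} :=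
    hmeas (measurableSet_singleton 0).compl
  rw [← hinv (QuotientGroup.mk (lowerTriangular a b ha)⁻¹ : PSL2R) _ hset] at hbase
  convert hbase using 2
  ext x
  simp only [Set.mem_ofPred_eq, Set.mem_preimage]
  rw [orbitEval_smul, inv_inv, lowerTriangular_mulVec]

/-- A subgroup of finite covolume has no nonzero invariant polynomials of positive degree. -/
theorem eq_zero_of_invariant (hcov : HasFiniteCovolume Γ) (hn1 : 1 ≤ n)
    (hf : ∀ γ ∈ Γ, repPSL n hn γ f = f) : f = 0 := by
  let : MeasurableSpace (PSL2R ⧸ Γ) := borel (PSL2R ⧸ Γ)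
  have : BorelSpace (PSL2R ⧸ Γ) := ⟨rfl⟩
  obtain ⟨μ, hfin, hμ, hinv⟩ := hcov
  -- A countable grid lets one `x` serve all points; the shift by 1 keeps them off the second axis.
  have hae : ∀ᵐ x ∂μ, ∀ k l : ℕ, orbitEval hf ![(k : ℝ) + 1, (l : ℝ) + 1] x = 0 := by
    simp only [ae_all_iff]
    exact fun k l => ae_orbitEval_eq_zero hn1 hf μ _ _ (by positivity)
  have : (ae μ).NeBot := ae_neBot.mpr hμ
  obtain ⟨x, hx⟩ := hae.exists
  obtain ⟨g, rfl⟩ := QuotientGroup.mk_surjective x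
  have hg : repPSL n hn g f = 0 := by
    apply Subtype.ext
    -- A polynomial vanishing on a product of infinite sets is zero.
    refine MvPolynomial.funext_set (fun _ => Set.range fun k : ℕ => (k : ℝ) + 1)
      (fun _ => Set.infinite_range_of_injective fun k l hkl => by simpa using hkl) fun p hp => ?_
    obtain ⟨k, hk⟩ := hp 0 trivial
    obtain ⟨l, hl⟩ := hp 1 trivial
    have hpkl : p = ![(k : ℝ) + 1, (l : ℝ) + 1] := by
      ext i
      fin_cases i
      · exact hk.symm
      · exact hl.symm
    rw [hpkl]
    simpa [orbitEval_mk] using hx k l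
  have : repPSL n hn g⁻¹ (repPSL n hn g f) = f := by
    rw [← Module.End.mul_apply, ← map_mul, inv_mul_cancel, map_one, Module.End.one_apply]
  rw [← this, hg, map_zero]

end Orbits

end HigherOrder

theorem mainTheorem8 (Γ : Subgroup HigherOrder.PSL2R) (hdisc : DiscreteTopology Γ)
    (hcov : HigherOrder.HasFiniteCovolume Γ)
    (htf : ∀ γ : Γ, IsOfFinOrder γ → γ = 1)
    (n : ℕ) (hn : Even n) (hn1 : 1 ≤ n) (q : ℕ) :
    HigherOrder.annihilatedBy ℝ (HigherOrder.PnModule n hn Γ)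
      (HigherOrder.augmentationIdeal ℝ Γ ^ q) = ⊥ := by
  refine HigherOrder.annihilatedBy_pow_eq_bot (fun v hv => ?_) q
  have hinv := HigherOrder.invariant_of_augmentationIdeal_smul_eq_zero _ v hv
  exact HigherOrder.eq_zero_of_invariant hcov hn1 (hn := hn) (f := v) fun γ hγ => hinv ⟨γ, hγ⟩
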